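/- Let $N,r\ge 2$, let $c_1,\dots,c_N\in\mathbb C$ be pairwise distinct, and let $\theta_{i\alpha},\theta_{\infty\alpha}\in\mathbb C$ ($1\le i\le N$, $1\le\alpha\le r$) satisfy $\sum_{i,\alpha}\theta_{i\alpha}+\sum_\alpha\theta_{\infty\alpha}=0$ and $\theta_{i\alpha}-\theta_{i\beta}\notin\mathbb Z$ for $\alpha\ne\beta$, $i=1,\dots,N,\infty$. Put $f(\lambda)=\prod_i(\lambda-c_i)$, $\delta_\ell=(N-1)\ell-N$ and $g=\sum_{\ell=2}^r\delta_\ell=\frac12(r-1)(rN-r-2)$. For $h=(h_I)\in\mathbb C^g$, $I=(m,\ell)$ with $2\le\ell\le r$, $0\le m\le\delta_\ell-1$, let $$\tilde F_h(\lambda,\tilde\mu)=\det\Bigl(f(\lambda)\sum_{i}\frac{\mathrm{diag}(\theta_{i1},\dots,\theta_{ir})}{\lambda-c_i}-\tilde\mu I\Bigr)+f(\lambda)\sum_{\ell=2}^r\sum_{m=0}^{\delta_\ell}h_{m\ell}\lambda^m\tilde\mu^{r-\ell},$$ where $h_{\delta_\ell,\ell}=(-1)^r\bigl(\sigma_\ell(\theta_{\infty1},\dots,\theta_{\infty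 r})-\sigma_\ell(-\sum_i\theta_{i1},\dots,-\sum_i\theta_{ir})\bigr)$ is fixed and $\sigma_\ell$ is the $\ell$-th elementary symmetric function. These are the spectral curves $$C_h=\{(\lambda,\mu):\lambda\ne c_i,\ \tilde F_h(\lambda,f(\lambda)\mu)=0\}$$ of matrices $\sum_iA_i/(\lambda-c_i)$ for which $A_i$ has the eigenvalues $\theta_{i\alpha}$ and $A_\infty=-\sum_iA_i$ has the eigenvalues $\theta_{\infty\alpha}$. On $C_h$ let $dS=\mu\,d\lambda$ and $$d\tilde\omega_I=\frac{\partial}{\partial h_I}dS=\frac{\partial\mu(h,\lambda)}{\partial h_I}\,d\lambda ,$$ where $\mu(h,\lambda)$ is the branch of the multivalued function defined by $C_h$ and $\lambda$ is held constant. Let $U\subset\mathbb C^g$ be open, and let $A_1,\dots,A_g$ be cycles transported continuously over $U$ (for instance the $A$-cycles of a symplectic homology basis): $A_J=A_J(h)$, $h\in U$, is a continuous family of closed piecewise $C^1$ loops on $C_h$ avoiding the ramification points of $(\lambda,\mu)\mapsto\lambda$. Let $a_J(h)=\oint_{A_J(h)}dS$. Then all the period integrals $\oint_{A_J}dS$,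 $\oint_{A_J}d\tilde\omega_I$ exist, the period map $h\mapsto a=(a_1,\dots,a_g)$ is complex differentiable on $U$, and its Jacobian matrix is the matrix of $A$-periods of the differentials $d\tilde\omega_I$: $$\frac{\partial a_J}{\partial h_I}=\oint_{A_J}d\tilde\omega_I .$$ In particular, if $d\omega_1,\dots,d\omega_g$ are differentials $d\omega_J=w_J\,d\lambda$ with $w_J$ continuous on the unramified part of $C_h$ (e.g. holomorphic differentials), normalized by $\oint_{A_K}d\omega_J=\delta_{JK}$, and $d\tilde\omega_I=\sum_J\mathcal A_{IJ}\,d\omega_J$, then $\mathcal A_{IJ}=\partial a_J/\partial h_I$. -/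

import Mathlib

open Set Filter Topology

noncomputable section

namespace SpectralFamily

/-- The degree bound `δ_ℓ = (N - 1) ℓ - N`. -/
def delta (N l : ℕ) : ℕ := (N - 1) * l - N

/-- The genus `g = (r - 1) (r N - r - 2) / 2` of the compactified spectral curve. -/
def genus (N r : ℕ) : ℕ := (r - 1) * (r * N - r - 2) / 2

/-- Labels of the isospectral invariants `h_{mℓ}`, `2 ≤ ℓ ≤ r`, `0 ≤ m ≤ δ_ℓ - 1`:
the pair `⟨k, m⟩` stands for `ℓ = k + 2` and `m`. -/
abbrev Label (N r : ℕ) : Type := Σ k : Fin (r - 1), Fin (delta N (k + 2))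

/-- The space of isospectral invariants `h = (h_{mℓ})`. -/
abbrev Invariants (N r : ℕ) : Type := Label N r → ℂ

/-- The number of isospectral invariants is the genus. -/
theorem card_label (N r : ℕ) (hN : 2 ≤ N) (hr : 2 ≤ r) :
    Fintype.card (Label N r) = genus N r := by
  obtain ⟨n, rfl⟩ : ∃ n, N = n + 2 := ⟨N - 2, by omega⟩
  obtain ⟨R, rfl⟩ : ∃ R, r = R + 2 := ⟨r - 2, by omega⟩
  have key : ∀ k : ℕ, delta (n + 2) (k + 2) = n * k + n + k := by
    intro k
    have h : (n + 2 - 1) * (k + 2) = (n * k + n + k) + (n + 2) := by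
      rw [show n + 2 - 1 = n + 1 by omega]; ring
    rw [delta, h]; omega
  have hsum : ∀ m : ℕ, 2 * ∑ k ∈ Finset.range (m + 1), (n * k + n + k)
      = (m + 1) * (n * (m + 2) + m) := by
    intro m
    induction m with
    | zero => simp; ring
    | succ m ih => rw [Finset.sum_range_succ, mul_add, ih]; ring
  have hg : (R + 2) * (n + 2) - (R + 2) - 2 = n * (R + 2) + R := by
    have h : (R + 2) * (n + 2) = (n * (R + 2) + R) + 2 + (R + 2) := by ring
    rw [h]; omega
  simp only [Fintype.card_sigma, Fintype.card_fin, key]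
  rw [genus, hg, show R + 2 - 1 = R + 1 by omega,
    Fin.sum_univ_eq_sum_range (fun k => n * k + n + k) (R + 1), ← hsum R]
  omega

/-- The fixed parameters of the family: the positions `c_i` of the `N` poles and the eigenvalues
`θ_{iα}`, `θ_{∞α}` of the `r × r` residue matrices `A_1, …, A_N` and `A_∞ = -∑ A_i`. -/
structure Data (N r : ℕ) where
  c : Fin N → ℂ
  θ : Fin N → Fin r → ℂ
  θinf : Fin r → ℂ
  c_injective : Function.Injective c
  trace_eq_zero : ∑ i, ∑ α, θ i α + ∑ α, θinf α = 0
  θ_sub_ne : ∀ i α β, α ≠ β → ∀ n : ℤ, θ i α - θ i β ≠ n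
  θinf_sub_ne : ∀ α β, α ≠ β → ∀ n : ℤ, θinf α - θinf β ≠ n

variable {N r : ℕ}

/-- `f(λ) = ∏ (λ - c_i)`. -/
def Data.f (D : Data N r) (lam : ℂ) : ℂ := ∏ i, (lam - D.c i)

/-- The polynomial matrix `f(λ) M(λ)` for `M(λ) = ∑ A_i / (λ - c_i)`. -/
def Data.scaledMatrix (D : Data N r) (A : Fin N → Matrix (Fin r) (Fin r) ℂ) (lam : ℂ) :
    Matrix (Fin r) (Fin r) ℂ :=
  ∑ i, (∏ j ∈ Finset.univ.erase i, (lam - D.c j)) • A i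

/-- The reference polynomial `det (f(λ) M⁰(λ) - μ̃)`, where `M⁰` has the diagonal residues
`diag (θ_{i1}, …, θ_{ir})`. -/
def Data.refPoly (D : Data N r) (lam nu : ℂ) : ℂ :=
  (D.scaledMatrix (fun i => Matrix.diagonal (D.θ i)) lam
    - nu • (1 : Matrix (Fin r) (Fin r) ℂ)).det

/-- The `ℓ`-th elementary symmetric function. -/
def elemSymm (l : ℕ) (x : Fin r → ℂ) : ℂ :=
  ∑ s ∈ Finset.powersetCard l Finset.univ, ∏ α ∈ s, x α

/-- The leading coefficient `h_{δ_ℓ,ℓ} = (-1)^r (σ_ℓ(A_∞) - σ_ℓ(A⁰_∞))`, which depends on the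
eigenvalues only. -/
def Data.leadCoeff (D : Data N r) (l : ℕ) : ℂ :=
  (-1) ^ r * (elemSymm l D.θinf - elemSymm l (fun α => -∑ i, D.θ i α))

/-- The polynomial `F̃_h(λ, μ̃)
= F̃⁰(λ, μ̃) + f(λ) ∑_{ℓ=2}^{r} ∑_{m=0}^{δ_ℓ} h_{mℓ} λ^m μ̃^{r-ℓ}`. -/
def Data.curvePoly (D : Data N r) (h : Invariants N r) (lam nu : ℂ) : ℂ :=
  D.refPoly lam nu + D.f lam *
    ∑ k : Fin (r - 1),
      ((∑ m : Fin (delta N (k + 2)), h ⟨k, m⟩ * lam ^ (m : ℕ))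
        + D.leadCoeff (k + 2) * lam ^ delta N (k + 2)) * nu ^ (r - (k + 2))

/-- The equation of the spectral curve in the coordinates `(λ, μ)`, `μ̃ = f(λ) μ`.
For `λ ≠ c_i` it is `f(λ)^r` times the characteristic polynomial `det (M(λ) - μ)`. -/
def Data.planePoly (D : Data N r) (h : Invariants N r) (lam mu : ℂ) : ℂ :=
  D.curvePoly h lam (D.f lam * mu)

/-- The plane spectral curve `C_h` over `ℂ ∖ {c_1, …, c_N}`: pairs `(λ, μ)` with
`F_h(λ, μ) = 0`. -/
def Data.curve (D : Data N r) (h : Invariants N r) : Set (ℂ × ℂ) :=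
  {p | (∀ i, p.1 ≠ D.c i) ∧ D.planePoly h p.1 p.2 = 0}

/-- The points of `C_h` at which `∂F_h/∂μ ≠ 0`, i.e. where `(λ, μ) ↦ λ` is unramified. -/
def Data.unramified (D : Data N r) (h : Invariants N r) : Set (ℂ × ℂ) :=
  {p | p ∈ D.curve h ∧ deriv (fun mu => D.planePoly h p.1 mu) p.2 ≠ 0}

/-- `m` is a branch near `(h, λ)` of the multivalued function `μ = μ(h, λ)`, with the value
`μ` at `(h, λ)`, where `p = (λ, μ)`. -/
def Data.IsBranch (D : Data N r) (h : Invariants N r) (p : ℂ × ℂ)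
    (m : Invariants N r × ℂ → ℂ) : Prop :=
  m (h, p.1) = p.2 ∧ ContinuousAt m (h, p.1) ∧
    ∀ᶠ x in 𝓝 (h, p.1), D.planePoly x.1 x.2 (m x) = 0

open Classical in
/-- The branch of `μ(h, λ)` through the point `p` of `C_h`. At an unramified point branches exist
and any two of them agree near `(h, λ)`. -/
def Data.branch (D : Data N r) (h : Invariants N r) (p : ℂ × ℂ) : Invariants N r × ℂ → ℂ :=
  if H : ∃ m, D.IsBranch h p m then H.choose else fun _ => 0

/-- `∂μ(h, λ)/∂h_I` at the point `p = (λ, μ)` of `C_h`, with `λ` held constant. -/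
def Data.dmu (D : Data N r) (h : Invariants N r) (I : Label N r) (p : ℂ × ℂ) : ℂ :=
  lineDeriv ℂ (fun h' : Invariants N r => D.branch h p (h', p.1)) h (Pi.single I 1)

/-- The differential `w dλ` with coefficient function `w`. -/
def lamForm (w : ℂ × ℂ → ℂ) : ℂ × ℂ → (ℂ × ℂ →L[ℂ] ℂ) :=
  fun p => w p • ContinuousLinearMap.fst ℂ ℂ ℂ

/-- The differential `dS = μ dλ`. -/
def dS : ℂ × ℂ → (ℂ × ℂ →L[ℂ] ℂ) := lamForm Prod.snd

/-- The differential `dω̃_I = ∂/∂h_I dS = (∂μ/∂h_I) dλ` on `C_h`. -/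
def Data.dωTilde (D : Data N r) (h : Invariants N r) (I : Label N r) : ℂ × ℂ → (ℂ × ℂ →L[ℂ] ℂ) :=
  lamForm (D.dmu h I)

/-- Piecewise continuously differentiable paths. -/
def IsPiecewiseC1 {a b : ℂ × ℂ} (γ : Path a b) : Prop :=
  ∃ (n : ℕ) (τ : ℕ → ℝ), Monotone τ ∧ τ 0 = 0 ∧ τ n = 1 ∧
    ∀ k < n, ContDiffOn ℝ 1 γ.extend (Icc (τ k) (τ (k + 1)))

/-- A closed cycle on the spectral curves `C_h`, transported continuously with `h ∈ U`: a
continuous family of closed piecewise `C¹` loops on `C_h` that avoid the ramification points.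
(The loops lie over `ℂ ∖ {c_i}`, hence avoid the poles of `dS`.) -/
structure CycleFamily (D : Data N r) (U : Set (Invariants N r)) where
  base : Invariants N r → ℂ × ℂ
  loop : ∀ h, Path (base h) (base h)
  continuousOn : ContinuousOn (fun x : Invariants N r × unitInterval => loop x.1 x.2) (U ×ˢ univ)
  isPiecewiseC1 : ∀ h ∈ U, IsPiecewiseC1 (loop h)
  mem_unramified : ∀ h ∈ U, ∀ t, loop h t ∈ D.unramified h

variable {D : Data N r} {U : Set (Invariants N r)} {ι : Type*}

/-- The period map `h ↦ a = (a_J)`, `a_J = ∮_{A_J} dS`. -/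
def periodMap (A : ι → CycleFamily D U) (h : Invariants N r) (J : ι) : ℂ :=
  curveIntegral dS ((A J).loop h)

/-- The matrix `(∮_{A_J} dω̃_I)_{IJ}` of `A`-periods. -/
def periodMatrix (A : ι → CycleFamily D U) (h : Invariants N r) : Matrix (Label N r) ι ℂ :=
  Matrix.of fun I J => curveIntegral (D.dωTilde h I) ((A J).loop h)

end SpectralFamily

end

open SpectralFamily

/-! Formally, ∂/∂h_I passes under ∮ μ dλ, but the loop moves with h, and only continuously: its
velocity need not vary continuously in h, so the integrands for h and h' cannot be compared
directly. The remedy is to compare primitives.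

Near an unramified point the curves are graphs of a holomorphic branch μ = m(h, λ), and m(h, ·) has
a primitive P h on a disc (`nonempty_localBranch`). Cut the loop at h into finitely many arcs, each
inside one such neighbourhood. For h' near h, the integral of μ dλ over an arc of the loop at h' is
a difference of values of P h'. It therefore equals the integral of m(h', λ) over the projected arc
of the loop at h, plus corrections at the two ends. Primitives through a common point differ by
constants (`LocalBranch.eventually_sub_eq`), so corrections at neighbouring arcs agree and
telescope; they cancel around the cycle because it is closed. The period is thus locally an integral
over a fixed λ-path, and dominated differentiation applies (`LocalBranch.hasFDerivAt_integral`,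
`hasFDerivAt_curveIntegral_dS`). The resulting integrand is -F_h / F_μ, which is ∂μ/∂h_I for every
choice of branch (`Data.dmu_eq`). -/

noncomputable section

namespace SpectralFamily

/-! ### Branches of implicitly defined functions -/

section Implicit

variable {X : Type*} [NormedAddCommGroup X] [NormedSpace ℂ X] {F : X × ℂ → ℂ} {v : X × ℂ}

/-- The derivative `-F_x / F_μ` of a function `μ(x)` implicitly defined by `F (x, μ) = 0`. -/
def implicitSlope (F : X × ℂ → ℂ) (v : X × ℂ) : X →L[ℂ] ℂ :=
  -(fderiv ℂ F v (0, 1))⁻¹ • (fderiv ℂ F v).comp (ContinuousLinearMap.inl ℂ X ℂ)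

theorem continuousAt_implicitSlope (hF : ContDiff ℂ 1 F) (hv : fderiv ℂ F v (0, 1) ≠ 0) :
    ContinuousAt (implicitSlope F) v := by
  have h1 : Continuous (fderiv ℂ F) := hF.continuous_fderiv one_ne_zero
  have h2 : Continuous fun w => fderiv ℂ F w ((0, 1) : X × ℂ) := h1.clm_apply continuous_const
  have h3 : Continuous fun w => (fderiv ℂ F w).comp (ContinuousLinearMap.inl ℂ X ℂ) :=
    h1.clm_comp continuous_const
  exact ((h2.continuousAt.inv₀ hv).neg).smul h3.continuousAt

theorem fderiv_comp_inr_eq (F : X × ℂ → ℂ) (v : X × ℂ) :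
    fderiv ℂ F v ∘L .inr ℂ X ℂ = fderiv ℂ F v (0, 1) • ContinuousLinearMap.id ℂ ℂ := by
  ext; simp

theorem isInvertible_fderiv_comp_inr (hv : fderiv ℂ F v (0, 1) ≠ 0) :
    (fderiv ℂ F v ∘L .inr ℂ X ℂ).IsInvertible := by
  rw [fderiv_comp_inr_eq]
  refine ⟨ContinuousLinearEquiv.smulLeft (Units.mk0 _ hv), ?_⟩
  ext; simp [Units.smul_def]

variable [CompleteSpace X]

/-- Continuity of `m` is enough: local uniqueness in the implicit function theorem identifies `m`
with the implicit function, and then `F (x, m x) = 0` may be differentiated. This covers branches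
obtained by an arbitrary choice. -/
theorem hasFDerivAt_of_implicit (hF : ContDiff ℂ 1 F) (hFv : F v = 0)
    (hv : fderiv ℂ F v (0, 1) ≠ 0) {m : X → ℂ} (hm : m v.1 = v.2) (hmc : ContinuousAt m v.1)
    (hm0 : ∀ᶠ x in 𝓝 v.1, F (x, m x) = 0) :
    HasFDerivAt m (implicitSlope F v) v.1 := by
  have hi := isInvertible_fderiv_comp_inr hv
  have hc : ContDiffAt ℂ 1 F v := hF.contDiffAt
  have hd := (hc.hasStrictFDerivAt_implicitFunction one_ne_zero hi).hasFDerivAt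
  have hiff := hc.eventually_apply_eq_iff_implicitFunction one_ne_zero hi
  have hlim : Tendsto (fun x => (x, m x)) (𝓝 v.1) (𝓝 v) := by
    have := continuousAt_id.prodMk hmc
    simpa [ContinuousAt, hm] using this
  have heq : m =ᶠ[𝓝 v.1] hc.implicitFunction one_ne_zero hi := by
    filter_upwards [hlim.eventually hiff, hm0] with x hx hx0
    exact (hx.1 (hx0.trans hFv.symm)).symm
  have hd' := hd.congr_of_eventuallyEq heq
  have hm1 : DifferentiableAt ℂ m v.1 := hd'.differentiableAt
  -- differentiate `F (x, m x) = 0`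
  have hcomp : HasFDerivAt (fun x => F (x, m x))
      ((fderiv ℂ F v).comp ((ContinuousLinearMap.id ℂ X).prod (fderiv ℂ m v.1))) v.1 := by
    have h1 : HasFDerivAt F (fderiv ℂ F v) (v.1, m v.1) := by
      rw [hm]; exact (hF.differentiable one_ne_zero v).hasFDerivAt
    exact h1.comp v.1 ((hasFDerivAt_id v.1).prodMk hm1.hasFDerivAt)
  have hzero : HasFDerivAt (fun x => F (x, m x)) (0 : X →L[ℂ] ℂ) v.1 :=
    (hasFDerivAt_const (0 : ℂ) v.1).congr_of_eventuallyEq hm0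
  have huniq := hcomp.unique hzero
  have : fderiv ℂ m v.1 = implicitSlope F v := by
    ext x
    have hx := DFunLike.congr_fun huniq x
    have hsplit : ((x, fderiv ℂ m v.1 x) : X × ℂ)
        = (x, 0) + fderiv ℂ m v.1 x • ((0, 1) : X × ℂ) := by simp
    simp only [ContinuousLinearMap.comp_apply, ContinuousLinearMap.prod_apply,
      ContinuousLinearMap.id_apply, zero_apply] at hx
    rw [hsplit, map_add, map_smul, smul_eq_mul] at hx
    simp only [implicitSlope, smul_apply, ContinuousLinearMap.comp_apply,
      ContinuousLinearMap.inl_apply, smul_eq_mul]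
    field_simp
    linear_combination hx
  rw [← this]
  exact hm1.hasFDerivAt

theorem exists_implicit_branch (hF : ContDiff ℂ 1 F) (hFv : F v = 0)
    (hv : fderiv ℂ F v (0, 1) ≠ 0) :
    ∃ m : X → ℂ, m v.1 = v.2 ∧ ContinuousAt m v.1 ∧
      ∃ ρ > 0, ∃ C : ℝ,
        (∀ x ∈ Metric.ball v.1 ρ, F (x, m x) = 0 ∧
          HasFDerivAt m (implicitSlope F (x, m x)) x ∧ ‖implicitSlope F (x, m x)‖ ≤ C) ∧
        ∀ w ∈ Metric.ball v ρ, F w = 0 → m w.1 = w.2 := by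
  have hi := isInvertible_fderiv_comp_inr hv
  have hc : ContDiffAt ℂ 1 F v := hF.contDiffAt
  set m := hc.implicitFunction one_ne_zero hi with hmdef
  have hm : m v.1 = v.2 := hc.implicitFunction_apply_self one_ne_zero hi
  have hm1 : ContDiffAt ℂ 1 m v.1 := hc.contDiffAt_implicitFunction one_ne_zero hi
  have hiff := hc.eventually_apply_eq_iff_implicitFunction one_ne_zero hi
  have h0 := hc.eventually_apply_implicitFunction one_ne_zero hi
  rw [← hmdef] at hiff h0
  rw [hFv] at hiff h0
  have hmc : ContinuousAt m v.1 := hm1.continuousAt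
  have hlim : Tendsto (fun x => (x, m x)) (𝓝 v.1) (𝓝 v) := by
    have := continuousAt_id.prodMk hmc
    simpa [ContinuousAt, hm] using this
  have hne : ∀ᶠ w in 𝓝 v, fderiv ℂ F w (0, 1) ≠ 0 :=
    (((hF.continuous_fderiv one_ne_zero).clm_apply continuous_const).continuousAt).eventually_ne hv
  have hbd : ∀ᶠ w in 𝓝 v, ‖implicitSlope F w‖ < ‖implicitSlope F v‖ + 1 :=
    (continuousAt_implicitSlope hF hv).norm.eventually_lt continuousAt_const (lt_add_one _)
  have hcont : ∀ᶠ x in 𝓝 v.1, ContinuousAt m x := by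
    filter_upwards [hm1.eventually (by simp)] with x hx using hx.continuousAt
  have hall : ∀ᶠ x in 𝓝 v.1, F (x, m x) = 0 ∧
      HasFDerivAt m (implicitSlope F (x, m x)) x ∧
      ‖implicitSlope F (x, m x)‖ ≤ ‖implicitSlope F v‖ + 1 := by
    -- The derivative formula at a nearby `x` needs the equation on a neighbourhood of `x`, hence
    -- `h0.eventually_nhds`.
    filter_upwards [h0, h0.eventually_nhds, hcont, hlim.eventually hne, hlim.eventually hbd]
      with x hx0 hx1 hxc hxn hxb
    exact ⟨hx0, hasFDerivAt_of_implicit hF hx0 hxn rfl hxc hx1, hxb.le⟩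
  obtain ⟨ρ₁, hρ₁, H₁⟩ := Metric.eventually_nhds_iff_ball.1 hall
  obtain ⟨ρ₂, hρ₂, H₂⟩ := Metric.eventually_nhds_iff_ball.1 hiff
  refine ⟨m, hm, hmc, min ρ₁ ρ₂, lt_min hρ₁ hρ₂, ‖implicitSlope F v‖ + 1, ?_, ?_⟩
  · exact fun x hx => H₁ x (Metric.ball_subset_ball (min_le_left _ _) hx)
  · exact fun w hw hw0 => (H₂ w (Metric.ball_subset_ball (min_le_right _ _) hw)).1 hw0

end Implicit

section LocalBranch

theorem mem_ball_prod_iff {X Y : Type*} [PseudoMetricSpace X] [PseudoMetricSpace Y] {p q : X × Y}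
    {ρ : ℝ} : p ∈ Metric.ball q ρ ↔ p.1 ∈ Metric.ball q.1 ρ ∧ p.2 ∈ Metric.ball q.2 ρ := by
  simp [Metric.mem_ball, Prod.dist_eq]

variable {E : Type*} [NormedAddCommGroup E] [NormedSpace ℂ E]

/-- A branch `μ = m (h, λ)` of the curves `F ((h, λ), μ) = 0` on a ball around `u`, together with
primitives `P h` of `λ ↦ m (h, λ)`. -/
structure LocalBranch (F : (E × ℂ) × ℂ → ℂ) (u : (E × ℂ) × ℂ) where
  m : E × ℂ → ℂ
  P : E → ℂ → ℂ
  ρ : ℝ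
  C : ℝ
  ρ_pos : 0 < ρ
  apply_self : m u.1 = u.2
  eq_zero : ∀ x ∈ Metric.ball u.1 ρ, F (x, m x) = 0
  hasFDerivAt : ∀ x ∈ Metric.ball u.1 ρ, HasFDerivAt m (implicitSlope F (x, m x)) x
  norm_le : ∀ x ∈ Metric.ball u.1 ρ, ‖implicitSlope F (x, m x)‖ ≤ C
  unique : ∀ w ∈ Metric.ball u ρ, F w = 0 → m w.1 = w.2
  hasDerivAt : ∀ x ∈ Metric.ball u.1 ρ, HasDerivAt (P x.1) (m x) x.2

variable {F : (E × ℂ) × ℂ → ℂ} {u : (E × ℂ) × ℂ}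

theorem nonempty_localBranch [CompleteSpace E] (hF : ContDiff ℂ 1 F) (hu : F u = 0)
    (hu' : fderiv ℂ F u (0, 1) ≠ 0) : Nonempty (LocalBranch F u) := by
  obtain ⟨m, hm, -, ρ, hρ, C, H, huniq⟩ := exists_implicit_branch hF hu hu'
  have hmem : ∀ h ∈ Metric.ball u.1.1 ρ, ∀ z ∈ Metric.ball u.1.2 ρ,
      ((h, z) : E × ℂ) ∈ Metric.ball u.1 ρ :=
    fun h hh z hz => mem_ball_prod_iff.2 ⟨hh, hz⟩
  have hprim : ∀ h : E, ∃ p : ℂ → ℂ, h ∈ Metric.ball u.1.1 ρ →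
      ∀ z ∈ Metric.ball u.1.2 ρ, HasDerivAt p (m (h, z)) z := by
    intro h
    by_cases hh : h ∈ Metric.ball u.1.1 ρ
    · have hd : DifferentiableOn ℂ (fun z => m (h, z)) (Metric.ball u.1.2 ρ) := by
        intro z hz
        have h1 : DifferentiableAt ℂ m (h, z) := (H _ (hmem h hh z hz)).2.1.differentiableAt
        exact (h1.comp z (by fun_prop : DifferentiableAt ℂ (fun z : ℂ => (h, z)) z)
          ).differentiableWithinAt
      -- A holomorphic function on a disc has a primitive. Nothing is asked about how `p` depends on
      -- `h`.
      obtain ⟨p, hp⟩ := hd.isExactOn_ball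
      exact ⟨p, fun _ z hz => hp z hz⟩
    · exact ⟨0, fun h' => absurd h' hh⟩
  choose P hP using hprim
  refine ⟨⟨m, P, ρ, C, hρ, hm, fun x hx => (H x hx).1, fun x hx => (H x hx).2.1,
    fun x hx => (H x hx).2.2, huniq, ?_⟩⟩
  intro x hx
  exact hP x.1 (mem_ball_prod_iff.1 hx).1 x.2 (mem_ball_prod_iff.1 hx).2

/-- Primitives belonging to two branches through a common point differ by constants. -/
theorem LocalBranch.eventually_sub_eq {u' : (E × ℂ) × ℂ} (B : LocalBranch F u)
    (B' : LocalBranch F u') (hu' : u' ∈ Metric.ball u B.ρ) (h0 : F u' = 0) :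
    ∀ᶠ y in 𝓝 u'.1, B.P y.1 y.2 - B.P y.1 u'.1.2 = B'.P y.1 y.2 - B'.P y.1 u'.1.2 := by
  have hu1 : u'.1 ∈ Metric.ball u.1 B.ρ := (mem_ball_prod_iff.1 hu').1
  have hm : B.m u'.1 = u'.2 := B.unique u' hu' h0
  have hlim : Tendsto (fun x => (x, B.m x)) (𝓝 u'.1) (𝓝 u') := by
    have := continuousAt_id.prodMk (B.hasFDerivAt _ hu1).continuousAt
    simpa [ContinuousAt, hm] using this
  have hev : ∀ᶠ x in 𝓝 u'.1, x ∈ Metric.ball u.1 B.ρ ∧ x ∈ Metric.ball u'.1 B'.ρ ∧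
      B.m x = B'.m x := by
    filter_upwards [Metric.isOpen_ball.mem_nhds hu1, Metric.ball_mem_nhds u'.1 B'.ρ_pos,
      hlim.eventually (Metric.ball_mem_nhds u' B'.ρ_pos)] with x hx hx' hxm
    exact ⟨hx, hx', (B'.unique _ hxm (B.eq_zero x hx)).symm⟩
  obtain ⟨δ, hδ, H⟩ := Metric.eventually_nhds_iff_ball.1 hev
  filter_upwards [Metric.ball_mem_nhds u'.1 hδ] with y hy
  have hball : ∀ z ∈ Metric.ball u'.1.2 δ, ((y.1, z) : E × ℂ) ∈ Metric.ball u'.1 δ :=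
    fun z hz => mem_ball_prod_iff.2 ⟨(mem_ball_prod_iff.1 hy).1, hz⟩
  have hy2 : y.2 ∈ Metric.ball u'.1.2 δ := (mem_ball_prod_iff.1 hy).2
  have hd : ∀ z ∈ Metric.ball u'.1.2 δ,
      HasDerivAt (fun z => B.P y.1 z - B'.P y.1 z) 0 z := by
    intro z hz
    obtain ⟨h1, h2, h3⟩ := H _ (hball z hz)
    have := (B.hasDerivAt _ h1).sub (B'.hasDerivAt _ h2)
    rwa [h3, sub_self] at this
  -- For fixed `y.1`, both primitives have the same derivative on the disc, since the two branches
  -- coincide near `u'.1`.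
  have hconst := (convex_ball u'.1.2 δ).is_const_of_fderivWithin_eq_zero (𝕜 := ℂ)
    (f := fun z => B.P y.1 z - B'.P y.1 z)
    (fun z hz => (hd z hz).differentiableAt.differentiableWithinAt)
    (fun z hz => by
      rw [fderivWithin_of_isOpen Metric.isOpen_ball hz]
      ext
      simp [(hd z hz).deriv]) hy2 (Metric.mem_ball_self hδ)
  linear_combination hconst

end LocalBranch

/-! ### Integration along piecewise `C¹` paths -/

section Paths

open MeasureTheory

theorem exists_mem_Ico_of_partition {τ : ℕ → ℝ} {n : ℕ} {t : ℝ} (h0 : τ 0 ≤ t) (h1 : t < τ n) :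
    ∃ k < n, t ∈ Ico (τ k) (τ (k + 1)) := by
  induction n with
  | zero => exact absurd h1 (not_lt.2 h0)
  | succ n ih =>
    by_cases h : t < τ n
    · obtain ⟨k, hk, hkt⟩ := ih h
      exact ⟨k, hk.trans n.lt_succ_self, hkt⟩
    · exact ⟨n, n.lt_succ_self, not_lt.1 h, h1⟩

variable {a b : ℂ × ℂ} {γ : Path a b}

theorem IsPiecewiseC1.intervalIntegrable_derivWithin (hγ : IsPiecewiseC1 γ) :
    IntervalIntegrable (derivWithin γ.extend unitInterval) volume 0 1 := by
  obtain ⟨n, τ, hmono, h0, h1, hC⟩ := hγ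
  rw [← h0, ← h1]
  refine IntervalIntegrable.trans_iterate fun k hk => ?_
  have hle : τ k ≤ τ (k + 1) := hmono k.le_succ
  -- The partition is only monotone; a one-point piece lacks unique differentiability but
  -- contributes nothing.
  rcases hle.eq_or_lt with heq | hlt
  · rw [heq]
  have hcont : ContinuousOn (derivWithin γ.extend (Icc (τ k) (τ (k + 1)))) (Icc (τ k) (τ (k + 1))) :=
    (hC k hk).continuousOn_derivWithin (uniqueDiffOn_Icc hlt) le_rfl
  -- The derivatives within the piece and within `unitInterval` may differ at the break points, a
  -- null set.
  refine (hcont.intervalIntegrable_of_Icc hle).congr_ae ?_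
  rw [uIoc_of_le hle, ← restrict_Ioo_eq_restrict_Ioc]
  filter_upwards [ae_restrict_mem measurableSet_Ioo] with t ht
  have h2 : Icc (τ k) (τ (k + 1)) ∈ 𝓝 t := Icc_mem_nhds ht.1 ht.2
  have hk0 : 0 ≤ τ k := h0 ▸ hmono k.zero_le
  have hk1 : τ (k + 1) ≤ 1 := h1 ▸ hmono hk
  have h3 : unitInterval ∈ 𝓝 t := mem_of_superset h2 (Icc_subset_Icc hk0 hk1)
  rw [derivWithin_of_mem_nhds h2, derivWithin_of_mem_nhds h3]

theorem IsPiecewiseC1.exists_countable_hasDerivAt (hγ : IsPiecewiseC1 γ) :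
    ∃ s : Set ℝ, s.Countable ∧ ∀ t ∈ Ioo (0 : ℝ) 1 \ s,
      HasDerivAt γ.extend (derivWithin γ.extend unitInterval t) t := by
  obtain ⟨n, τ, hmono, h0, h1, hC⟩ := hγ
  refine ⟨range τ, countable_range τ, fun t ht => ?_⟩
  obtain ⟨k, hk, hkt⟩ := exists_mem_Ico_of_partition (τ := τ) (n := n)
    (h0.trans_le ht.1.1.le) (ht.1.2.trans_eq h1.symm)
  have hne : τ k ≠ t := fun h => ht.2 ⟨k, h⟩
  have h2 : Icc (τ k) (τ (k + 1)) ∈ 𝓝 t := Icc_mem_nhds (lt_of_le_of_ne hkt.1 hne) hkt.2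
  have hd : DifferentiableAt ℝ γ.extend t :=
    ((hC k hk).differentiableOn one_ne_zero t (mem_of_mem_nhds h2)).differentiableAt h2
  rw [derivWithin_of_mem_nhds (Icc_mem_nhds ht.1.1 ht.1.2)]
  exact hd.hasDerivAt

theorem IsPiecewiseC1.intervalIntegrable_fst (hγ : IsPiecewiseC1 γ) {s t : ℝ} (hs : 0 ≤ s)
    (hst : s ≤ t) (ht : t ≤ 1) :
    IntervalIntegrable (fun x => (derivWithin γ.extend unitInterval x).1) volume s t := by
  have h : IntervalIntegrable (fun x => (derivWithin γ.extend unitInterval x).1) volume 0 1 := by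
    have h := hγ.intervalIntegrable_derivWithin
    rw [intervalIntegrable_iff] at h ⊢
    exact h.fst
  refine h.mono_set ?_
  rw [uIcc_of_le hst, uIcc_of_le zero_le_one]
  exact Icc_subset_Icc hs ht

theorem curveIntegralFun_lamForm (w : ℂ × ℂ → ℂ) (γ : Path a b) (t : ℝ) :
    curveIntegralFun (lamForm w) γ t
      = w (γ.extend t) * (derivWithin γ.extend unitInterval t).1 := by
  rw [curveIntegralFun_def]
  simp [lamForm]

theorem continuousOn_comp_extend {Y : Type*} [TopologicalSpace Y] {w : ℂ × ℂ → Y}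
    {S : Set (ℂ × ℂ)} (hw : ContinuousOn w S) (hS : ∀ t, γ t ∈ S) (I : Set ℝ) :
    ContinuousOn (fun t => w (γ.extend t)) I :=
  hw.comp γ.continuous_extend.continuousOn fun _ _ => hS _

theorem IsPiecewiseC1.curveIntegrable_lamForm (hγ : IsPiecewiseC1 γ) {w : ℂ × ℂ → ℂ}
    {S : Set (ℂ × ℂ)} (hw : ContinuousOn w S) (hS : ∀ t, γ t ∈ S) :
    CurveIntegrable (lamForm w) γ := by
  have h : curveIntegralFun (lamForm w) γ
      = fun t => w (γ.extend t) * (derivWithin γ.extend unitInterval t).1 :=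
    funext (curveIntegralFun_lamForm w γ)
  rw [CurveIntegrable, h]
  exact (hγ.intervalIntegrable_fst le_rfl zero_le_one le_rfl).continuousOn_mul
    (continuousOn_comp_extend hw hS _)

/-- The fundamental theorem of calculus for the pull-back of `g dλ = dp`. -/
theorem IsPiecewiseC1.integral_eq_sub (hγ : IsPiecewiseC1 γ) {s t : ℝ} (hs : 0 ≤ s)
    (hst : s ≤ t) (ht : t ≤ 1) {p : ℂ → ℂ} {g : ℝ → ℂ} (hg : ContinuousOn g (Icc s t))
    (hp : ∀ x ∈ Icc s t, HasDerivAt p (g x) (γ.extend x).1) :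
    ∫ x in s..t, g x * (derivWithin γ.extend unitInterval x).1
      = p (γ.extend t).1 - p (γ.extend s).1 := by
  obtain ⟨S, hS, hd⟩ := hγ.exists_countable_hasDerivAt
  refine integral_eq_of_hasDerivAt_off_countable_of_le (fun x => p (γ.extend x).1) _ hst hS ?_ ?_ ?_
  · intro x hx
    refine ContinuousAt.continuousWithinAt ?_
    exact ContinuousAt.comp (g := p) (f := fun x => (γ.extend x).1) (hp x hx).continuousAt
      (continuous_fst.comp γ.continuous_extend).continuousAt
  · intro x hx
    have h1 := hd x ⟨⟨hs.trans_lt hx.1.1, hx.1.2.trans_le ht⟩, hx.2⟩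
    have h2 : HasDerivAt (fun x => (γ.extend x).1) (derivWithin γ.extend unitInterval x).1 x := by
      have := (ContinuousLinearMap.fst ℝ ℂ ℂ).hasFDerivAt.comp_hasDerivAt x h1
      exact this
    exact (hp x (Ioo_subset_Icc_self hx.1)).comp x h2
  · refine (hγ.intervalIntegrable_fst hs hst ht).continuousOn_mul ?_
    rwa [uIcc_of_le hst]

end Paths

/-! ### Differentiation of periods of `μ dλ` -/

section Periods

open MeasureTheory

variable {E : Type*} [NormedAddCommGroup E] [NormedSpace ℂ E] {F : (E × ℂ) × ℂ → ℂ}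

/-- The path is fixed and only `B.m` depends on the parameter, so the uniform bound `B.C` on the
slope permits differentiation under the integral sign. Nonvanishing of F_μ is required at `h` alone,
where it makes the slope continuous, hence measurable, along the path. -/
theorem LocalBranch.hasFDerivAt_integral {u : (E × ℂ) × ℂ} (B : LocalBranch F u)
    (hF : ContDiff ℂ 1 F) {a b : ℂ × ℂ} {γ : Path a b} (hγ : IsPiecewiseC1 γ) {s t : ℝ}
    (hs : 0 ≤ s) (hst : s ≤ t) (ht : t ≤ 1) {h : E} (hh : h ∈ Metric.ball u.1.1 B.ρ)
    (hball : ∀ x ∈ Icc s t, (γ.extend x).1 ∈ Metric.ball u.1.2 B.ρ)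
    (hne : ∀ x ∈ Icc s t,
      fderiv ℂ F ((h, (γ.extend x).1), B.m (h, (γ.extend x).1)) (0, 1) ≠ 0) :
    HasFDerivAt
      (fun h' => ∫ x in s..t, B.m (h', (γ.extend x).1) * (derivWithin γ.extend unitInterval x).1)
      (∫ x in s..t, (derivWithin γ.extend unitInterval x).1 •
        (implicitSlope F ((h, (γ.extend x).1), B.m (h, (γ.extend x).1))).comp
          (ContinuousLinearMap.inl ℂ E ℂ)) h := by
  have hI := hγ.intervalIntegrable_fst hs hst ht
  have hmem : ∀ h' ∈ Metric.ball u.1.1 B.ρ, ∀ x ∈ Icc s t,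
      ((h', (γ.extend x).1) : E × ℂ) ∈ Metric.ball u.1 B.ρ :=
    fun h' hh' x hx => mem_ball_prod_iff.2 ⟨hh', hball x hx⟩
  have hfst : Continuous fun x => (γ.extend x).1 := continuous_fst.comp γ.continuous_extend
  have hmcont : ∀ h' ∈ Metric.ball u.1.1 B.ρ,
      ContinuousOn (fun x => B.m (h', (γ.extend x).1)) (Icc s t) := fun h' hh' x hx =>
    (ContinuousAt.comp (g := B.m) (f := fun x => (h', (γ.extend x).1))
      (B.hasFDerivAt _ (hmem h' hh' x hx)).continuousAt
      (by fun_prop)).continuousWithinAt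
  have hint : ∀ h' ∈ Metric.ball u.1.1 B.ρ, IntervalIntegrable
      (fun x => B.m (h', (γ.extend x).1) * (derivWithin γ.extend unitInterval x).1) volume s t := by
    intro h' hh'
    refine hI.continuousOn_mul ?_
    rw [uIcc_of_le hst]
    exact hmcont h' hh'
  have hslope : ContinuousOn (fun x =>
      (implicitSlope F ((h, (γ.extend x).1), B.m (h, (γ.extend x).1))).comp
        (ContinuousLinearMap.inl ℂ E ℂ)) (Icc s t) := by
    refine ContinuousOn.clm_comp ?_ continuousOn_const
    intro x hx
    have h1 : ContinuousWithinAt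
        (fun x => (((h, (γ.extend x).1), B.m (h, (γ.extend x).1)) : (E × ℂ) × ℂ)) (Icc s t) x :=
      ((continuous_const.prodMk hfst).continuousWithinAt).prodMk (hmcont h hh x hx)
    exact ContinuousAt.comp_continuousWithinAt (g := implicitSlope F)
      (continuousAt_implicitSlope hF (hne x hx)) h1
  have hsub : uIoc s t ⊆ Icc s t := by rw [uIoc_of_le hst]; exact Ioc_subset_Icc_self
  refine intervalIntegral.hasFDerivAt_integral_of_dominated_of_fderiv_le
    (F' := fun h' x => (derivWithin γ.extend unitInterval x).1 •
        (implicitSlope F ((h', (γ.extend x).1), B.m (h', (γ.extend x).1))).comp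
          (ContinuousLinearMap.inl ℂ E ℂ))
    (bound := fun x => ‖(derivWithin γ.extend unitInterval x).1‖ *
      (B.C * ‖ContinuousLinearMap.inl ℂ E ℂ‖))
    (Metric.isOpen_ball.mem_nhds hh) ?_ (hint h hh) ?_ ?_ ?_ ?_
  · filter_upwards [Metric.isOpen_ball.mem_nhds hh] with h' hh'
    exact (intervalIntegrable_iff.1 (hint h' hh')).aestronglyMeasurable
  · refine (intervalIntegrable_iff.1 hI).aestronglyMeasurable.smul ?_
    exact (hslope.mono hsub).aestronglyMeasurable measurableSet_uIoc
  · refine Eventually.of_forall fun x hx h' hh' => ?_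
    rw [norm_smul]
    refine mul_le_mul_of_nonneg_left ?_ (norm_nonneg _)
    refine (ContinuousLinearMap.opNorm_comp_le _ _).trans ?_
    exact mul_le_mul_of_nonneg_right (B.norm_le _ (hmem h' hh' x (hsub hx))) (norm_nonneg _)
  · exact hI.norm.mul_const _
  · refine Eventually.of_forall fun x hx h' hh' => ?_
    have h1 := B.hasFDerivAt _ (hmem h' hh' x (hsub hx))
    have h2 : HasFDerivAt (fun h' : E => ((h', (γ.extend x).1) : E × ℂ))
        (ContinuousLinearMap.inl ℂ E ℂ) h' := hasFDerivAt_prodMk_left h' _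
    exact (h1.comp h' h2).mul_const _

variable [CompleteSpace E]

theorem hasFDerivAt_curveIntegral_dS (hF : ContDiff ℂ 1 F) {U : Set E} (hU : IsOpen U)
    {base : E → ℂ × ℂ} (loop : ∀ h, Path (base h) (base h))
    (hcont : ContinuousOn (fun x : E × unitInterval => loop x.1 x.2) (U ×ˢ univ))
    (hpc : ∀ h ∈ U, IsPiecewiseC1 (loop h))
    (hzero : ∀ h ∈ U, ∀ t, F ((h, (loop h t).1), (loop h t).2) = 0)
    (hne : ∀ h ∈ U, ∀ t, fderiv ℂ F ((h, (loop h t).1), (loop h t).2) (0, 1) ≠ 0)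
    {h : E} (hh : h ∈ U) :
    HasFDerivAt (fun h' => curveIntegral dS (loop h'))
      (∫ x in (0 : ℝ)..1, (derivWithin (loop h).extend unitInterval x).1 •
        (implicitSlope F ((h, ((loop h).extend x).1), ((loop h).extend x).2)).comp
          (ContinuousLinearMap.inl ℂ E ℂ)) h := by
  set u : E → unitInterval → (E × ℂ) × ℂ := fun h' t => ((h', (loop h' t).1), (loop h' t).2) with hu
  -- Primitives are attached to points `v` rather than to times `t`, so that `t = 0` and `t = 1`,
  -- which give the same point of the closed loop, receive the same primitive.
  have hB : ∀ v : (E × ℂ) × ℂ, ∃ P : E → ℂ → ℂ, F v = 0 → fderiv ℂ F v (0, 1) ≠ 0 →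
      ∃ B : LocalBranch F v, B.P = P := by
    intro v
    by_cases hv : F v = 0 ∧ fderiv ℂ F v (0, 1) ≠ 0
    · obtain ⟨B⟩ := nonempty_localBranch hF hv.1 hv.2
      exact ⟨B.P, fun _ _ => ⟨B, rfl⟩⟩
    · exact ⟨0, fun h1 h2 => absurd ⟨h1, h2⟩ hv⟩
  choose P hP using hB
  have hB : ∀ t, ∃ B : LocalBranch F (u h t), B.P = P (u h t) :=
    fun t => hP _ (hzero h hh t) (hne h hh t)
  choose B hBP using hB
  have hucont : ∀ t, ContinuousAt (fun x : E × unitInterval => u x.1 x.2) (h, t) := by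
    intro t
    have h1 : ContinuousAt (fun x : E × unitInterval => loop x.1 x.2) (h, t) :=
      hcont.continuousAt (prod_mem_nhds (hU.mem_nhds hh) univ_mem)
    exact (continuousAt_fst.prodMk h1.fst).prodMk h1.snd
  have htube : ∀ t₀, ∃ V ∈ 𝓝 h, ∃ W : Set unitInterval, IsOpen W ∧ t₀ ∈ W ∧
      ∀ h' ∈ V, ∀ t ∈ W, u h' t ∈ Metric.ball (u h t₀) (B t₀).ρ := by
    intro t₀
    have h1 := (hucont t₀).eventually (Metric.ball_mem_nhds (u h t₀) (B t₀).ρ_pos)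
    obtain ⟨V, hV, W, hW, hVW⟩ := mem_nhds_prod_iff.1 h1
    obtain ⟨W', hW', hWo, hmW⟩ := mem_nhds_iff.1 hW
    exact ⟨V, hV, W', hWo, hmW, fun h' hh' t ht => hVW (mk_mem_prod hh' (hW' ht))⟩
  choose V hV W hWo hmW htube using htube
  -- Compactness of the parameter interval leaves finitely many arcs, each in one branch
  -- neighbourhood.
  obtain ⟨s, hs0, hmono, ⟨n, hn⟩, hcov⟩ :=
    exists_monotone_Icc_subset_open_cover_unitInterval hWo
      (fun t _ => mem_iUnion.2 ⟨t, hmW t⟩)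
  choose i hi using hcov
  have hs0' : ((s 0 : unitInterval) : ℝ) = 0 := by rw [hs0]; rfl
  have hsn : ((s n : unitInterval) : ℝ) = 1 := by rw [hn n le_rfl]; rfl
  have hle : ∀ k, (s k : ℝ) ≤ s (k + 1) := fun k => hmono k.le_succ
  have hproj : ∀ k, ∀ x ∈ Icc (s k : ℝ) (s (k + 1)),
      projIcc 0 1 zero_le_one x ∈ Icc (s k) (s (k + 1)) := by
    intro k x hx
    have h1 := monotone_projIcc (zero_le_one (α := ℝ)) hx.1
    have h2 := monotone_projIcc (zero_le_one (α := ℝ)) hx.2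
    rw [projIcc_val] at h1 h2
    exact ⟨h1, h2⟩
  have hW : ∀ k, ∀ x ∈ Icc (s k : ℝ) (s (k + 1)), projIcc 0 1 zero_le_one x ∈ W (i k) :=
    fun k x hx => hi k (hproj k x hx)
  have hself : ∀ k, ∀ t ∈ W (i k), u h t ∈ Metric.ball (u h (i k)) (B (i k)).ρ :=
    fun k t ht => htube _ h (mem_of_mem_nhds (hV _)) t ht
  have hmself : ∀ k, ∀ t ∈ W (i k), (B (i k)).m (h, (loop h t).1) = (loop h t).2 :=
    fun k t ht => (B (i k)).unique _ (hself k t ht) (hzero h hh t)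
  -- The candidate for the period: the branches at `h'` integrated over the λ-projection of the loop
  -- at `h`.
  set G : E → ℂ := fun h' => ∑ k ∈ Finset.range n, ∫ x in (s k : ℝ)..s (k + 1),
    (B (i k)).m (h', ((loop h).extend x).1) *
      (derivWithin (loop h).extend unitInterval x).1 with hG
  -- the derivative of `G`
  have hGd : HasFDerivAt G (∫ x in (0 : ℝ)..1, (derivWithin (loop h).extend unitInterval x).1 •
        (implicitSlope F ((h, ((loop h).extend x).1), ((loop h).extend x).2)).comp
          (ContinuousLinearMap.inl ℂ E ℂ)) h := by
    have hsum : ∫ x in (0 : ℝ)..1, (derivWithin (loop h).extend unitInterval x).1 •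
        (implicitSlope F ((h, ((loop h).extend x).1), ((loop h).extend x).2)).comp
          (ContinuousLinearMap.inl ℂ E ℂ)
        = ∑ k ∈ Finset.range n, ∫ x in (s k : ℝ)..s (k + 1),
          (derivWithin (loop h).extend unitInterval x).1 •
            (implicitSlope F ((h, ((loop h).extend x).1),
              (B (i k)).m (h, ((loop h).extend x).1))).comp (ContinuousLinearMap.inl ℂ E ℂ) := by
      rw [← hs0', ← hsn, ← intervalIntegral.sum_integral_adjacent_intervals
        (a := fun k => (s k : ℝ))]
      · refine Finset.sum_congr rfl fun k _ => intervalIntegral.integral_congr fun x hx => ?_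
        rw [uIcc_of_le (hle k)] at hx
        have hm : (B (i k)).m (h, ((loop h).extend x).1) = ((loop h).extend x).2 :=
          hmself k _ (hW k x hx)
        simp only [hm]
      · intro k _
        refine ((hpc h hh).intervalIntegrable_fst (s k).2.1 (hle k) (s (k + 1)).2.2).smul_continuousOn
          (ContinuousOn.clm_comp ?_ continuousOn_const)
        intro x _
        have h1 : ContinuousAt (fun x : ℝ =>
            (((h, ((loop h).extend x).1), ((loop h).extend x).2) : (E × ℂ) × ℂ)) x := by
          have := (loop h).continuous_extend
          fun_prop
        exact (ContinuousAt.comp (g := implicitSlope F)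
          (f := fun x : ℝ => (((h, ((loop h).extend x).1), ((loop h).extend x).2) : (E × ℂ) × ℂ))
          (continuousAt_implicitSlope hF (hne h hh _)) h1).continuousWithinAt
    rw [hsum]
    refine HasFDerivAt.fun_sum fun k _ => ?_
    refine (B (i k)).hasFDerivAt_integral hF (hpc h hh) (s k).2.1 (hle k) (s (k + 1)).2.2
      (Metric.mem_ball_self (B (i k)).ρ_pos) (fun x hx => ?_) (fun x hx => ?_)
    · exact (mem_ball_prod_iff.1 (mem_ball_prod_iff.1 (hself k _ (hW k x hx))).1).2
    · have hm : (B (i k)).m (h, ((loop h).extend x).1) = ((loop h).extend x).2 :=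
          hmself k _ (hW k x hx)
      rw [hm]
      exact hne h hh _
  refine hGd.congr_of_eventuallyEq ?_
  -- comparison of the period with `G`
  set Q : E → unitInterval → ℂ := fun h' t =>
    P (u h t) h' (loop h' t).1 - P (u h t) h' (loop h t).1 with hQ
  have hQev : ∀ k, ∀ t ∈ W (i k), ∀ᶠ h' in 𝓝 h,
      (B (i k)).P h' (loop h' t).1 - (B (i k)).P h' (loop h t).1 = Q h' t := by
    intro k t ht
    have h1 := (B (i k)).eventually_sub_eq (B t) (hself k t ht) (hzero h hh t)
    have h2 : Tendsto (fun h' => (u h' t).1) (𝓝 h) (𝓝 (u h t).1) :=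
      (ContinuousAt.comp (g := fun x : E × unitInterval => u x.1 x.2) (f := fun h' => (h', t))
        (hucont t) (by fun_prop)).fst
    filter_upwards [h2.eventually h1] with h' hh'
    rw [hBP t] at hh'
    exact hh'
  have hev : ∀ᶠ h' in 𝓝 h, ∀ k ∈ Finset.range n, h' ∈ V (i k) ∧
      (B (i k)).P h' (loop h' (s k)).1 - (B (i k)).P h' (loop h (s k)).1 = Q h' (s k) ∧
      (B (i k)).P h' (loop h' (s (k + 1))).1 - (B (i k)).P h' (loop h (s (k + 1))).1
        = Q h' (s (k + 1)) := by
    refine (Finset.eventually_all _).2 fun k _ => ?_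
    filter_upwards [hV (i k), hQev k (s k) (hi k ⟨le_rfl, hle k⟩),
      hQev k (s (k + 1)) (hi k ⟨hle k, le_rfl⟩)] with h' h1 h2 h3 using ⟨h1, h2, h3⟩
  filter_upwards [hev, hU.mem_nhds hh] with h' hh' hU'
  have hper : curveIntegral dS (loop h') = ∑ k ∈ Finset.range n, ∫ x in (s k : ℝ)..s (k + 1),
      ((loop h').extend x).2 * (derivWithin (loop h').extend unitInterval x).1 := by
    rw [curveIntegral_def, intervalIntegral.sum_integral_adjacent_intervals
        (a := fun k => (s k : ℝ)) (f := fun x =>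
          ((loop h').extend x).2 * (derivWithin (loop h').extend unitInterval x).1), hs0', hsn]
    · exact intervalIntegral.integral_congr fun x _ => curveIntegralFun_lamForm _ _ x
    · intro k _
      exact ((hpc h' hU').intervalIntegrable_fst (s k).2.1 (hle k) (s (k + 1)).2.2).continuousOn_mul
        (continuous_snd.comp (loop h').continuous_extend).continuousOn
  have hpiece : ∀ k ∈ Finset.range n,
      ∫ x in (s k : ℝ)..s (k + 1),
        ((loop h').extend x).2 * (derivWithin (loop h').extend unitInterval x).1
      = (∫ x in (s k : ℝ)..s (k + 1), (B (i k)).m (h', ((loop h).extend x).1) *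
          (derivWithin (loop h).extend unitInterval x).1) + (Q h' (s (k + 1)) - Q h' (s k)) := by
    intro k hk
    obtain ⟨hVk, hQ0, hQ1⟩ := hh' k hk
    have htb : ∀ x ∈ Icc (s k : ℝ) (s (k + 1)),
        u h' (projIcc 0 1 zero_le_one x) ∈ Metric.ball (u h (i k)) (B (i k)).ρ :=
      fun x hx => htube _ h' hVk _ (hW k x hx)
    have hb : ∀ x ∈ Icc (s k : ℝ) (s (k + 1)),
        ((h', ((loop h).extend x).1) : E × ℂ) ∈ Metric.ball (u h (i k)).1 (B (i k)).ρ :=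
      fun x hx => mem_ball_prod_iff.2
        ⟨(mem_ball_prod_iff.1 (mem_ball_prod_iff.1 (htb x hx)).1).1,
          (mem_ball_prod_iff.1 (mem_ball_prod_iff.1 (hself k _ (hW k x hx))).1).2⟩
    have e1 := (hpc h' hU').integral_eq_sub (s k).2.1 (hle k) (s (k + 1)).2.2
      (p := (B (i k)).P h') (g := fun x => ((loop h').extend x).2)
      (continuous_snd.comp (loop h').continuous_extend).continuousOn (fun x hx => by
        have h1 := (B (i k)).hasDerivAt _ (mem_ball_prod_iff.1 (htb x hx)).1
        rwa [(B (i k)).unique _ (htb x hx) (hzero h' hU' _)] at h1)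
    have e2 := (hpc h hh).integral_eq_sub (s k).2.1 (hle k) (s (k + 1)).2.2
      (p := (B (i k)).P h') (g := fun x => (B (i k)).m (h', ((loop h).extend x).1))
      (fun x hx => by
        have h1 : ContinuousAt (fun x : ℝ => ((h', ((loop h).extend x).1) : E × ℂ)) x := by
          have := (loop h).continuous_extend
          fun_prop
        exact (ContinuousAt.comp (g := (B (i k)).m)
          (f := fun x : ℝ => ((h', ((loop h).extend x).1) : E × ℂ))
          ((B (i k)).hasFDerivAt _ (hb x hx)).continuousAt h1).continuousWithinAt)
      (fun x hx => (B (i k)).hasDerivAt _ (hb x hx))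
    rw [e1, e2, ← hQ0, ← hQ1]
    simp only [Path.extend_apply _ (s k).2, Path.extend_apply _ (s (k + 1)).2, Subtype.coe_eta]
    ring
  -- Here closedness of both loops enters.
  have hQ01 : Q h' (s n) = Q h' (s 0) := by
    rw [hn n le_rfl, hs0]
    simp [hQ, hu]
  rw [hper, Finset.sum_congr rfl hpiece, Finset.sum_add_distrib,
    Finset.sum_range_sub (fun k => Q h' (s k)), hQ01, sub_self, add_zero]

end Periods

/-! ### The family of spectral curves -/

section Curves

open MeasureTheory

variable {N r : ℕ} (D : Data N r)

/-- The equation of all curves `C_h` at once, as a function of `((h, λ), μ)`. -/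
def Data.totalPoly (v : (Invariants N r × ℂ) × ℂ) : ℂ := D.planePoly v.1.1 v.1.2 v.2

theorem Data.contDiff_totalPoly : ContDiff ℂ 1 D.totalPoly := by
  have hf : ContDiff ℂ 1 fun v : (Invariants N r × ℂ) × ℂ => D.f v.1.2 := by
    unfold Data.f
    exact contDiff_prod fun i _ => by fun_prop
  have hnu : ContDiff ℂ 1 fun v : (Invariants N r × ℂ) × ℂ => D.f v.1.2 * v.2 :=
    hf.mul contDiff_snd
  have hh : ∀ I, ContDiff ℂ 1 fun v : (Invariants N r × ℂ) × ℂ => v.1.1 I := fun I =>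
    (contDiff_apply ℂ ℂ I).comp (contDiff_fst.comp contDiff_fst)
  unfold Data.totalPoly Data.planePoly Data.curvePoly
  refine ContDiff.add ?_ (hf.mul ?_)
  · unfold Data.refPoly
    simp only [Matrix.det_apply]
    refine ContDiff.sum fun σ _ => ContDiff.const_smul _ (contDiff_prod fun i _ => ?_)
    simp only [Matrix.sub_apply, Matrix.smul_apply, smul_eq_mul, Data.scaledMatrix,
      Matrix.sum_apply]
    refine ContDiff.sub (ContDiff.sum fun j _ => ContDiff.mul ?_ contDiff_const)
      (hnu.mul contDiff_const)
    exact contDiff_prod fun k _ => by fun_prop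
  · refine ContDiff.sum fun k _ => ContDiff.mul (ContDiff.add ?_ ?_) (hnu.pow _)
    · exact ContDiff.sum fun m _ => (hh _).mul (by fun_prop)
    · fun_prop

theorem Data.deriv_planePoly (h : Invariants N r) (p : ℂ × ℂ) :
    deriv (fun mu => D.planePoly h p.1 mu) p.2
      = fderiv ℂ D.totalPoly ((h, p.1), p.2) (0, 1) := by
  have h1 : HasFDerivAt D.totalPoly (fderiv ℂ D.totalPoly ((h, p.1), p.2)) ((h, p.1), p.2) :=
    (D.contDiff_totalPoly.differentiable one_ne_zero _).hasFDerivAt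
  have h2 : HasDerivAt (fun mu : ℂ => (((h, p.1), mu) : (Invariants N r × ℂ) × ℂ)) (0, 1) p.2 :=
    (hasDerivAt_const p.2 (h, p.1)).prodMk (hasDerivAt_id p.2)
  exact (h1.comp_hasDerivAt p.2 h2).deriv

variable {D}

theorem Data.fderiv_totalPoly_ne_zero {h : Invariants N r} {p : ℂ × ℂ}
    (hp : p ∈ D.unramified h) : fderiv ℂ D.totalPoly ((h, p.1), p.2) (0, 1) ≠ 0 := by
  rw [← D.deriv_planePoly]
  exact hp.2

theorem Data.isBranch_branch {h : Invariants N r} {p : ℂ × ℂ} (hp : p ∈ D.unramified h) :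
    D.IsBranch h p (D.branch h p) := by
  have hex : ∃ m, D.IsBranch h p m := by
    obtain ⟨m, hm, hmc, ρ, hρ, C, H, -⟩ := exists_implicit_branch D.contDiff_totalPoly
      (v := ((h, p.1), p.2)) hp.1.2 (Data.fderiv_totalPoly_ne_zero hp)
    refine ⟨m, hm, hmc, ?_⟩
    filter_upwards [Metric.ball_mem_nhds _ hρ] with x hx using (H x hx).1
  rw [Data.branch, dif_pos hex]
  exact hex.choose_spec

/-- The arbitrary choice in `Data.branch` has no effect, since the slope depends on the point alone.
-/
theorem Data.dmu_eq {h : Invariants N r} {p : ℂ × ℂ} (hp : p ∈ D.unramified h)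
    (I : Label N r) :
    D.dmu h I p = implicitSlope D.totalPoly ((h, p.1), p.2) (Pi.single I 1, 0) := by
  obtain ⟨hm, hmc, hm0⟩ := Data.isBranch_branch hp
  have h1 : HasFDerivAt (D.branch h p) (implicitSlope D.totalPoly ((h, p.1), p.2)) (h, p.1) :=
    hasFDerivAt_of_implicit D.contDiff_totalPoly (v := ((h, p.1), p.2)) hp.1.2
      (Data.fderiv_totalPoly_ne_zero hp) hm hmc hm0
  have h2 : HasFDerivAt (fun h' : Invariants N r => D.branch h p (h', p.1))
      ((implicitSlope D.totalPoly ((h, p.1), p.2)).comp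
        (ContinuousLinearMap.inl ℂ (Invariants N r) ℂ)) h :=
    h1.comp h (hasFDerivAt_prodMk_left h p.1)
  rw [Data.dmu, (h2.hasLineDerivAt _).lineDeriv]
  simp

theorem Data.continuousOn_implicitSlope (h : Invariants N r) :
    ContinuousOn (fun p : ℂ × ℂ => implicitSlope D.totalPoly ((h, p.1), p.2))
      (D.unramified h) := fun p hp =>
  (ContinuousAt.comp (g := implicitSlope D.totalPoly) (f := fun p : ℂ × ℂ => ((h, p.1), p.2))
    (continuousAt_implicitSlope D.contDiff_totalPoly (Data.fderiv_totalPoly_ne_zero hp))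
    (by fun_prop)).continuousWithinAt

theorem Data.continuousOn_dmu (h : Invariants N r) (I : Label N r) :
    ContinuousOn (D.dmu h I) (D.unramified h) :=
  ((Data.continuousOn_implicitSlope h).clm_apply continuousOn_const).congr
    fun _ hp => Data.dmu_eq hp I

variable {U : Set (Invariants N r)} {h : Invariants N r}

theorem CycleFamily.curveIntegrable_dωTilde (A : CycleFamily D U) (hh : h ∈ U) (I : Label N r) :
    CurveIntegrable (D.dωTilde h I) (A.loop h) :=
  (A.isPiecewiseC1 h hh).curveIntegrable_lamForm (Data.continuousOn_dmu h I)
    (A.mem_unramified h hh)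

theorem CycleFamily.hasFDerivAt_period (A : CycleFamily D U) (hU : IsOpen U) (hh : h ∈ U) :
    HasFDerivAt (fun h' => curveIntegral dS (A.loop h'))
      (∑ I, curveIntegral (D.dωTilde h I) (A.loop h) •
        ContinuousLinearMap.proj (R := ℂ) (φ := fun _ : Label N r => ℂ) I) h := by
  have hd := hasFDerivAt_curveIntegral_dS D.contDiff_totalPoly hU A.loop A.continuousOn
    A.isPiecewiseC1 (fun h hh t => (A.mem_unramified h hh t).1.2)
    (fun h hh t => Data.fderiv_totalPoly_ne_zero (A.mem_unramified h hh t)) hh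
  refine hd.congr_fderiv ?_
  have hint : IntervalIntegrable (fun x => (derivWithin (A.loop h).extend unitInterval x).1 •
      (implicitSlope D.totalPoly ((h, ((A.loop h).extend x).1), ((A.loop h).extend x).2)).comp
        (ContinuousLinearMap.inl ℂ (Invariants N r) ℂ)) volume 0 1 :=
    ((A.isPiecewiseC1 h hh).intervalIntegrable_fst le_rfl zero_le_one le_rfl).smul_continuousOn
      (ContinuousOn.clm_comp
        (continuousOn_comp_extend (Data.continuousOn_implicitSlope h) (A.mem_unramified h hh) _)
        continuousOn_const)
  -- Linear maps on the finite product agree once they agree on the coordinate vectors, so the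
  -- operator-valued integral is evaluated on each `Pi.single I 1`.
  refine ContinuousLinearMap.coe_injective (LinearMap.pi_ext' fun I => LinearMap.ext_ring ?_)
  have happ := ContinuousLinearMap.intervalIntegral_apply hint (Pi.single I 1)
  simp only [LinearMap.comp_apply, LinearMap.coe_single, ContinuousLinearMap.coe_coe]
  refine happ.trans ?_
  rw [sum_apply, Finset.sum_eq_single I (fun K _ hK => by simp [hK]) (by simp)]
  simp only [smul_apply, ContinuousLinearMap.proj_apply, Pi.single_eq_same, smul_eq_mul, mul_one]
  rw [curveIntegral_def]
  refine intervalIntegral.integral_congr fun x _ => ?_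
  simp only [Data.dωTilde, curveIntegralFun_lamForm]
  rw [Data.dmu_eq (p := (A.loop h).extend x) (A.mem_unramified h hh _), mul_comm]
  rfl

theorem CycleFamily.hasLineDerivAt_period (A : CycleFamily D U) (hU : IsOpen U) (hh : h ∈ U)
    (I : Label N r) :
    HasLineDerivAt ℂ (fun h' => curveIntegral dS (A.loop h'))
      (curveIntegral (D.dωTilde h I) (A.loop h)) h (Pi.single I 1) := by
  have := (A.hasFDerivAt_period hU hh).hasLineDerivAt (Pi.single I 1)
  rwa [sum_apply, Finset.sum_eq_single I (fun K _ hK => by simp [hK]) (by simp),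
    smul_apply, ContinuousLinearMap.proj_apply, Pi.single_eq_same, smul_eq_mul, mul_one] at this

theorem CycleFamily.curveIntegral_dωTilde_eq_sum {κ : Type*} [Fintype κ] (A : CycleFamily D U)
    (hh : h ∈ U) {I : Label N r} {w : κ → ℂ × ℂ → ℂ} {c : κ → ℂ}
    (hw : ∀ J, ContinuousOn (w J) (D.unramified h))
    (hc : ∀ p ∈ D.unramified h, D.dωTilde h I p = ∑ J, c J • lamForm (w J) p) :
    curveIntegral (D.dωTilde h I) (A.loop h)
      = ∑ J, c J * curveIntegral (lamForm (w J)) (A.loop h) := by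
  simp only [curveIntegral_def, ← intervalIntegral.integral_const_mul]
  rw [← intervalIntegral.integral_finsetSum]
  · refine intervalIntegral.integral_congr fun x _ => ?_
    simp only [curveIntegralFun_def]
    rw [hc ((A.loop h).extend x) (A.mem_unramified h hh _)]
    simp
  · exact fun J _ => IntervalIntegrable.const_mul
      ((A.isPiecewiseC1 h hh).curveIntegrable_lamForm (hw J) (A.mem_unramified h hh)) _

end Curves

end SpectralFamily

end

theorem mainTheorem6 (N r : ℕ) (hN : 2 ≤ N) (hr : 2 ≤ r) (D : Data N r)
    (U : Set (Invariants N r)) (hU : IsOpen U)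
    (A : Fin (genus N r) → CycleFamily D U)
    (h : Invariants N r) (hh : h ∈ U) :
    -- the period integrals exist
    (∀ J, CurveIntegrable dS ((A J).loop h)) ∧
    (∀ I J, CurveIntegrable (D.dωTilde h I) ((A J).loop h)) ∧
    -- the period map is differentiable and its Jacobian matrix is the matrix of `A`-periods
    HasFDerivAt (fun h' : Invariants N r => periodMap A h')
      (Matrix.vecMulLinear (periodMatrix A h)).toContinuousLinearMap h ∧
    (∀ (I : Label N r) (J : Fin (genus N r)),
      HasLineDerivAt ℂ (fun h' : Invariants N r => periodMap A h' J)
        (curveIntegral (D.dωTilde h I) ((A J).loop h)) h (Pi.single I 1)) ∧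
    -- the same matrix expresses the `dω̃_I` through normalized differentials `dω_J = w_J dλ`
    (∀ (w : Fin (genus N r) → ℂ × ℂ → ℂ) (𝒜 : Matrix (Label N r) (Fin (genus N r)) ℂ),
      (∀ J, ContinuousOn (w J) (D.unramified h)) →
      (∀ J K, curveIntegral (lamForm (w J)) ((A K).loop h) = if J = K then 1 else 0) →
      (∀ I, ∀ p ∈ D.unramified h, D.dωTilde h I p = ∑ J, 𝒜 I J • lamForm (w J) p) →
      ∀ I J, HasLineDerivAt ℂ (fun h' : Invariants N r => periodMap A h' J)
        (𝒜 I J) h (Pi.single I 1)) := by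
  refine ⟨fun J => ((A J).isPiecewiseC1 h hh).curveIntegrable_lamForm
      continuous_snd.continuousOn ((A J).mem_unramified h hh),
    fun I J => (A J).curveIntegrable_dωTilde hh I, ?_,
    fun I J => (A J).hasLineDerivAt_period hU hh I, ?_⟩
  · refine hasFDerivAt_pi'.2 fun J => ((A J).hasFDerivAt_period hU hh).congr_fderiv ?_
    ext v
    simp [periodMatrix, Matrix.vecMul, dotProduct, mul_comm]
  · intro w 𝒜 hw hnorm hc I J
    have hline := (A J).hasLineDerivAt_period hU hh I
    rw [(A J).curveIntegral_dωTilde_eq_sum hh hw (hc I)] at hline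
    simpa [hnorm, periodMap] using hline
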